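/- Let $\Gamma$ be an infinite finitely generated group acting on the right on a set $S$, let $o\in S$, and let $\Lambda$ be a finitely generated (possibly finite) group. Let $\mu$ and $\nu$ be symmetric finitely supported probability measures on $\Gamma$ and $\Lambda$. The permutational wreath product $\Lambda\wr_S\Gamma$ is the set $\Lambda^S\times\Gamma$ with multiplication $(\ell,g)(\ell',g')=(\ell'',gg')$, where $\ell''(s)=\ell(s)\,\ell'(s.g)$. For $l\in\Lambda$ let $\bar l\in\Lambda\wr_S\Gamma$ be the element $(\ell,\mathrm{id}_\Gamma)$ with $\ell(o)=l$ and $\ell(s)=\mathrm{id}_\Lambda$ for $s\ne o$, and identify $g\in\Gamma$ with $(\mathrm{id},g)$. Let $L_i,L_i'$ (with law $\nu$) and $G_i$ (with law $\mu$), $i\ge 1$, be independent, and let $$X_n=\prod_{i=1}^n \bar L_i\,G_i\,\bar L_i',\qquad Y_n=G_1\cdots G_n,\qquad T=\min\{k\ge 1: o.Y_k=o\}\in\mathbb N\cup\{\infty\}.$$ For a discrete random variable $Z$ let $H(Z)=-\sum_z \mathbf P(Z=z)\log \mathbf P(Z=z)$. Let $h(n)=H(R_n)$, where $R_n=L_1\cdots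 L_n$ is the random walk on $\Lambda$ with step law $\nu$, extended to real arguments by linear interpolation between the integers. Then there is an absolute constant $c>0$ (independent of $\Gamma,\Lambda,S,o,\mu,\nu,n,p$) such that for every $n\ge 1$ and every real $p$ with $0<p\le \mathbf P(T>n)$, $$H(X_n)\ \ge\ c\,n\,p\,h(1/p).$$ -/

import Mathlib

open MeasureTheory
open scoped RightActions SemidirectProduct

noncomputable section

namespace SwitchWalk

/-- The right action of `Γ` on `S` induces an action of `Γ` on `S → Λ` by automorphisms permuting
the coordinates: `g` sends `ℓ` to the configuration `s ↦ ℓ (s.g)`. Right actions of `Γ` are actions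
of `Γᵐᵒᵖ`, and `s <• g` is `s.g`. -/
def permute (Γ Λ S : Type*) [Group Γ] [Group Λ] [MulAction Γᵐᵒᵖ S] :
    Γ →* MulAut (S → Λ) where
  toFun g :=
    { toFun := fun ℓ s => ℓ (s <• g)
      invFun := fun ℓ s => ℓ (s <• g⁻¹)
      left_inv := fun ℓ => by funext s; simp [smul_smul]
      right_inv := fun ℓ => by funext s; simp [smul_smul]
      map_mul' := fun _ _ => rfl }
  map_one' := by ext ℓ s; simp
  map_mul' g g' := by ext ℓ s; simp [mul_smul]

/-- The permutational wreath product `Λ ≀_S Γ`, the semidirect product of `Λ^S` and `Γ`, with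
`(ℓ, g) (ℓ', g') = (ℓ · (s ↦ ℓ' (s.g)), g g')`. -/
abbrev PermWreath (Γ Λ S : Type*) [Group Γ] [Group Λ] [MulAction Γᵐᵒᵖ S] : Type _ :=
  (S → Λ) ⋊[permute Γ Λ S] Γ

theorem permWreath_mul {Γ Λ S : Type*} [Group Γ] [Group Λ] [MulAction Γᵐᵒᵖ S]
    (ℓ ℓ' : S → Λ) (g g' : Γ) :
    (⟨ℓ, g⟩ * ⟨ℓ', g'⟩ : PermWreath Γ Λ S) = ⟨fun s => ℓ s * ℓ' (s <• g), g * g'⟩ := rfl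

open Classical in
/-- The switch `(L̄, id)`, where `L̄` is `l` at the root `o` and the identity elsewhere. -/
def switch {Γ Λ S : Type*} [Group Γ] [Group Λ] [MulAction Γᵐᵒᵖ S] (o : S) (l : Λ) :
    PermWreath Γ Λ S :=
  ⟨fun s => if s = o then l else 1, 1⟩

/-- The element `g` of `Γ`, regarded as the element `(id, g)` of the wreath product. -/
def move {Γ Λ S : Type*} [Group Γ] [Group Λ] [MulAction Γᵐᵒᵖ S] (g : Γ) : PermWreath Γ Λ S :=
  ⟨fun _ => 1, g⟩

/-- The walk with steps `x 0, x 1, …`: its position at time `n` is `x 0 * x 1 * ⋯ * x (n - 1)`. -/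
def walk {A : Type*} [Monoid A] (x : ℕ → A) : ℕ → A
  | 0 => 1
  | n + 1 => walk x n * x n

/-- The law of a sequence of independent random elements, each with law `ρ`. -/
def iid {A : Type*} [MeasurableSpace A] (ρ : Measure A) [IsProbabilityMeasure ρ] :
    Measure (ℕ → A) :=
  Measure.infinitePi fun _ : ℕ => ρ

/-- The Shannon entropy (with the natural logarithm) of a discrete random element `X`. -/
def entropy {Ω E : Type*} [MeasurableSpace Ω] (P : Measure Ω) (X : Ω → E) : ℝ :=
  ∑' x : E, Real.negMulLog (P.real {ω | X ω = x})

/-- The piecewise linear function on `[0, ∞)` interpolating the values of `f` at the integers. -/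
def linearInterpolation (f : ℕ → ℝ) (x : ℝ) : ℝ :=
  f ⌊x⌋₊ + (x - ⌊x⌋₊) * (f (⌊x⌋₊ + 1) - f ⌊x⌋₊)

/-- The entropy `h n = H(R_n)` of the random walk `R_n = L_1 ⋯ L_n` with step law `ν`. -/
def walkEntropy {Λ : Type*} [Group Λ] [MeasurableSpace Λ] (ν : Measure Λ) [IsProbabilityMeasure ν]
    (n : ℕ) : ℝ :=
  entropy (iid ν) fun l : ℕ → Λ => walk l n

/-- The law of the randomness of the switch-walk-switch walk: a sequence of independent triples
`(L_i, G_i, L'_i)` with independent entries, `L_i` and `L'_i` of law `ν` and `G_i` of law `μ`. -/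
def pathLaw {Γ Λ : Type*} [MeasurableSpace Γ] [MeasurableSpace Λ]
    (μ : Measure Γ) (ν : Measure Λ) [IsProbabilityMeasure μ] [IsProbabilityMeasure ν] :
    Measure (ℕ → Λ × Γ × Λ) :=
  iid (ν.prod (μ.prod ν))

/-- The switch-walk-switch walk `X_n = ∏_{i ≤ n} L̄_i G_i L̄'_i`. -/
def switchWalkSwitch {Γ Λ S : Type*} [Group Γ] [Group Λ] [MulAction Γᵐᵒᵖ S] (o : S)
    (n : ℕ) (ω : ℕ → Λ × Γ × Λ) : PermWreath Γ Λ S :=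
  walk (fun i => switch o (ω i).1 * move (ω i).2.1 * switch o (ω i).2.2) n

/-- The position `Y_n` in `Γ` of the switch-walk-switch walk. -/
def baseWalk {Γ Λ : Type*} [Group Γ] (n : ℕ) (ω : ℕ → Λ × Γ × Λ) : Γ :=
  walk (fun i => (ω i).2.1) n

/-- The first return time `T = min {k ≥ 1 : o.Y_k = o}` (infinite if there is no return). -/
def returnTime {Γ Λ S : Type*} [Group Γ] [MulAction Γᵐᵒᵖ S] (o : S) (ω : ℕ → Λ × Γ × Λ) : ℕ∞ :=
  ⨅ (k : ℕ) (_ : 1 ≤ k ∧ o <• (baseWalk k ω : Γ) = o), (k : ℕ∞)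

end SwitchWalk

end

noncomputable section

namespace SwitchWalk

/-! Condition on the path `u` of the walk in `Γ`. Then the final position is known and the lamps at
distinct points of `S` are independent. The lamp at `s` is a product of as many independent
`ν`-steps as there are switches at `s`, so the conditional entropy is the sum over `s` of `h(c_s)`,
where `c_s` counts the switches at `s` (`shannon_list_prod_lamp`). Concavity of entropy
(`expect_shannon_le`) bounds `H(X_n)` below by the mean of this sum.

Since `h` is monotone and subadditive, `h(m) ≥ h(M) m / (2M)` for `m ≤ M`. Subtracting a quadratic
term gives `h(m) ≥ h(M)/(2M) · (m - m²/M)` for every `m` (`le_shannon_pow`). Summed over the sites,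
the linear terms add up to `2n` and the quadratic ones to the number of pairs of switches made at
the same site, so only a second-moment bound is needed. A last-visit decomposition bounds the mean
number of visits to `o` by `1/p` (`mul_meanVisits_le`), hence the mean number of pairs by `8n/p`
(`mul_expect_collisions_le`). With `M = ⌈8/p⌉` at least half of the linear term survives, and `Mp ≤
9` gives the constant `1/18`.

Laws are finitely supported elements of the monoid algebra over `ℝ`: convolution is the product
there, and the law of a walk is a power of its step law. -/

/-! ### Shannon entropy of finitely supported weights -/

open Real in
theorem negMulLog_add_le {x y : ℝ} (hx : 0 ≤ x) (hy : 0 ≤ y) :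
    negMulLog (x + y) ≤ negMulLog x + negMulLog y := by
  rcases hx.eq_or_lt with rfl | hx
  · simp
  rcases hy.eq_or_lt with rfl | hy
  · simp
  have h1 : log x ≤ log (x + y) := log_le_log hx (by linarith)
  have h2 : log y ≤ log (x + y) := log_le_log hy (by linarith)
  simp only [negMulLog]
  nlinarith [mul_le_mul_of_nonneg_left h1 hx.le, mul_le_mul_of_nonneg_left h2 hy.le]

open Real in
theorem negMulLog_sum_le {ι : Type*} (I : Finset ι) {w : ι → ℝ} (hw : ∀ i ∈ I, 0 ≤ w i) :
    negMulLog (∑ i ∈ I, w i) ≤ ∑ i ∈ I, negMulLog (w i) := by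
  classical
  induction I using Finset.induction_on with
  | empty => simp
  | insert a I ha ih =>
    rw [Finset.sum_insert ha, Finset.sum_insert ha]
    have hI : ∀ i ∈ I, 0 ≤ w i := fun i hi => hw i (Finset.mem_insert_of_mem hi)
    exact (negMulLog_add_le (hw a (Finset.mem_insert_self _ _)) (Finset.sum_nonneg hI)).trans
      (by linarith [ih hI])

/-- The Shannon entropy of a finitely supported weight, regarded as an element of the monoid
algebra. -/
def shannon {W : Type*} (x : MonoidAlgebra ℝ W) : ℝ :=
  x.coeff.sum fun _ r => Real.negMulLog r

theorem shannon_eq_sum {W : Type*} (x : MonoidAlgebra ℝ W) {t : Finset W}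
    (ht : x.coeff.support ⊆ t) : shannon x = ∑ a ∈ t, Real.negMulLog (x.coeff a) :=
  Finsupp.sum_of_support_subset _ ht _ (by simp)

theorem shannon_eq_tsum {W : Type*} (x : MonoidAlgebra ℝ W) :
    shannon x = ∑' a, Real.negMulLog (x.coeff a) := by
  rw [shannon_eq_sum x subset_rfl, tsum_eq_sum]
  intro a ha
  simp [Finsupp.notMem_support_iff.1 ha]

theorem coeff_sum_single {ι W : Type*} [DecidableEq W] (I : Finset ι) (φ : ι → W) (w : ι → ℝ)
    (a : W) :
    (∑ i ∈ I, MonoidAlgebra.single (φ i) (w i)).coeff a = ∑ i ∈ I with φ i = a, w i := by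
  simp [MonoidAlgebra.coeff_sum, Finsupp.finsetSum_apply, Finsupp.single_apply, Finset.sum_filter]

theorem support_sum_single_subset {ι W : Type*} [DecidableEq W] (I : Finset ι) (φ : ι → W)
    (w : ι → ℝ) :
    (∑ i ∈ I, MonoidAlgebra.single (φ i) (w i)).coeff.support ⊆ I.image φ := by
  intro a ha
  rw [Finsupp.mem_support_iff, coeff_sum_single] at ha
  obtain ⟨i, hi, -⟩ := Finset.exists_ne_zero_of_sum_ne_zero ha
  rw [Finset.mem_filter] at hi
  exact Finset.mem_image.2 ⟨i, hi.1, hi.2⟩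

/-- Merging atoms lowers entropy, because `negMulLog` is subadditive on nonnegative reals. Applied
to a product of laws, this yields subadditivity of entropy under convolution. -/
theorem shannon_sum_single_le {ι W : Type*} (I : Finset ι) (φ : ι → W) {w : ι → ℝ}
    (hw : ∀ i ∈ I, 0 ≤ w i) :
    shannon (∑ i ∈ I, MonoidAlgebra.single (φ i) (w i)) ≤ ∑ i ∈ I, Real.negMulLog (w i) := by
  classical
  rw [shannon_eq_sum _ (support_sum_single_subset I φ w),
    ← Finset.sum_fiberwise_of_maps_to (s := I) (t := I.image φ) (g := φ)
      (fun i hi => Finset.mem_image_of_mem _ hi) fun i => Real.negMulLog (w i)]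
  refine Finset.sum_le_sum fun a _ => ?_
  rw [coeff_sum_single]
  exact negMulLog_sum_le _ fun i hi => hw i (Finset.mem_filter.1 hi).1

theorem shannon_sum_single {ι W : Type*} (I : Finset ι) (φ : ι → W) (w : ι → ℝ)
    (hφ : Set.InjOn φ I) :
    shannon (∑ i ∈ I, MonoidAlgebra.single (φ i) (w i)) = ∑ i ∈ I, Real.negMulLog (w i) := by
  classical
  rw [shannon_eq_sum _ (support_sum_single_subset I φ w), Finset.sum_image hφ]
  refine Finset.sum_congr rfl fun i hi => ?_
  rw [coeff_sum_single]
  congr 1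
  rw [Finset.sum_eq_single_of_mem i (by simp [hi])]
  intro j hj hji
  rw [Finset.mem_filter] at hj
  exact absurd (hφ hj.1 hi hj.2) hji

theorem eq_sum_single {W : Type*} (x : MonoidAlgebra ℝ W) :
    x = ∑ a ∈ x.coeff.support, MonoidAlgebra.single a (x.coeff a) :=
  (MonoidAlgebra.sum_coeff_single x).symm

theorem shannon_mapDomain {W W' : Type*} {φ : W → W'} (hφ : Function.Injective φ)
    (x : MonoidAlgebra ℝ W) : shannon (x.mapDomain φ) = shannon x := by
  have : x.mapDomain φ =
      ∑ a ∈ x.coeff.support, MonoidAlgebra.single (φ a) (x.coeff a) := by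
    apply MonoidAlgebra.coeff_injective
    rw [MonoidAlgebra.coeff_sum]
    rfl
  rw [this, shannon_sum_single _ _ _ hφ.injOn]
  rfl

theorem mul_eq_sum_single {W : Type*} [Monoid W] (x y : MonoidAlgebra ℝ W) :
    x * y = ∑ i ∈ x.coeff.support ×ˢ y.coeff.support,
      MonoidAlgebra.single (i.1 * i.2) (x.coeff i.1 * y.coeff i.2) := by
  conv_lhs => rw [eq_sum_single x, eq_sum_single y, Finset.sum_mul_sum, ← Finset.sum_product']
  simp [MonoidAlgebra.single_mul_single]

/-! ### Probability laws in the monoid algebra and their convolutions -/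

/-- The total mass of a finitely supported weight, as an algebra homomorphism. -/
def mass {W : Type*} [Monoid W] : MonoidAlgebra ℝ W →ₐ[ℝ] ℝ :=
  MonoidAlgebra.lift ℝ ℝ W 1

theorem mass_single {W : Type*} [Monoid W] (a : W) (r : ℝ) :
    mass (MonoidAlgebra.single a r) = r := by
  simp [mass]

theorem mass_eq_sum {W : Type*} [Monoid W] (x : MonoidAlgebra ℝ W) :
    mass x = ∑ a ∈ x.coeff.support, x.coeff a := by
  conv_lhs => rw [eq_sum_single x]
  simp [mass_single]

theorem sum_negMulLog_mul {W : Type*} [Monoid W] (x y : MonoidAlgebra ℝ W) :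
    ∑ i ∈ x.coeff.support ×ˢ y.coeff.support, Real.negMulLog (x.coeff i.1 * y.coeff i.2) =
      mass y * shannon x + mass x * shannon y := by
  simp only [Real.negMulLog_mul, Finset.sum_add_distrib, mass_eq_sum, shannon, Finsupp.sum,
    Finset.sum_mul_sum, Finset.sum_product]
  rw [Finset.sum_comm]

/-- A finitely supported probability measure, as an element of the monoid algebra. -/
structure IsLaw {W : Type*} [Monoid W] (x : MonoidAlgebra ℝ W) : Prop where
  nonneg : ∀ a, 0 ≤ x.coeff a
  mass_eq : mass x = 1

theorem isLaw_single {W : Type*} [Monoid W] (a : W) :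
    IsLaw (MonoidAlgebra.single a (1 : ℝ)) where
  nonneg b := by
    classical
    rw [MonoidAlgebra.coeff_single, Finsupp.single_apply]
    split_ifs <;> norm_num
  mass_eq := mass_single a 1

theorem isLaw_sum {W : Type*} [Monoid W] {ι : Type*} (I : Finset ι) {w : ι → ℝ}
    {f : ι → MonoidAlgebra ℝ W} (hw : ∀ i ∈ I, 0 ≤ w i) (hw1 : ∑ i ∈ I, w i = 1)
    (hf : ∀ i ∈ I, IsLaw (f i)) : IsLaw (∑ i ∈ I, w i • f i) where
  nonneg a := by
    rw [MonoidAlgebra.coeff_sum, Finsupp.finsetSum_apply]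
    exact Finset.sum_nonneg fun i hi => mul_nonneg (hw i hi) ((hf i hi).nonneg a)
  mass_eq := by
    rw [map_sum, ← hw1]
    refine Finset.sum_congr rfl fun i hi => ?_
    rw [map_smul, (hf i hi).mass_eq, smul_eq_mul, mul_one]

theorem mul_eq_sum_smul {W : Type*} [Monoid W] (x y : MonoidAlgebra ℝ W) :
    x * y = ∑ b ∈ y.coeff.support, y.coeff b • (x * MonoidAlgebra.single b 1) := by
  conv_lhs => rw [eq_sum_single y, Finset.mul_sum]
  refine Finset.sum_congr rfl fun b _ => ?_
  rw [← mul_smul_comm, MonoidAlgebra.smul_single, smul_eq_mul, mul_one]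

theorem IsLaw.mul {W : Type*} [Monoid W] {x y : MonoidAlgebra ℝ W} (hx : IsLaw x)
    (hy : IsLaw y) : IsLaw (x * y) where
  nonneg a := by
    classical
    rw [mul_eq_sum_single, coeff_sum_single]
    exact Finset.sum_nonneg fun i _ => mul_nonneg (hx.nonneg _) (hy.nonneg _)
  mass_eq := by rw [map_mul, hx.mass_eq, hy.mass_eq, one_mul]

theorem isLaw_one {W : Type*} [Monoid W] : IsLaw (1 : MonoidAlgebra ℝ W) := isLaw_single 1

theorem IsLaw.pow {W : Type*} [Monoid W] {x : MonoidAlgebra ℝ W} (hx : IsLaw x) (n : ℕ) :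
    IsLaw (x ^ n) := by
  induction n with
  | zero => rw [pow_zero]; exact isLaw_one
  | succ n ih => rw [pow_succ]; exact ih.mul hx

theorem isLaw_list_prod {W : Type*} [Monoid W] {l : List (MonoidAlgebra ℝ W)}
    (hl : ∀ x ∈ l, IsLaw x) : IsLaw l.prod := by
  induction l with
  | nil => exact isLaw_one
  | cons x l ih =>
    rw [List.prod_cons]
    exact (hl x (by simp)).mul (ih fun y hy => hl y (by simp [hy]))

theorem IsLaw.mapDomain {W W' : Type*} [Monoid W] [Monoid W'] (φ : W → W')
    {x : MonoidAlgebra ℝ W} (hx : IsLaw x) : IsLaw (x.mapDomain φ) := by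
  have : x.mapDomain φ =
      ∑ a ∈ x.coeff.support, x.coeff a • MonoidAlgebra.single (φ a) (1 : ℝ) := by
    apply MonoidAlgebra.coeff_injective
    simp only [MonoidAlgebra.smul_single, smul_eq_mul, mul_one]
    rw [MonoidAlgebra.coeff_sum]
    rfl
  rw [this]
  exact isLaw_sum _ (fun _ _ => hx.nonneg _) (by rw [← mass_eq_sum, hx.mass_eq])
    fun _ _ => isLaw_single _

theorem IsLaw.coeff_le_one {W : Type*} [Monoid W] {x : MonoidAlgebra ℝ W} (hx : IsLaw x) (a : W) :
    x.coeff a ≤ 1 := by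
  by_cases ha : a ∈ x.coeff.support
  · rw [← hx.mass_eq, mass_eq_sum]
    exact Finset.single_le_sum (f := fun a => x.coeff a) (fun b _ => hx.nonneg b) ha
  · rw [Finsupp.notMem_support_iff.1 ha]; exact zero_le_one

theorem IsLaw.shannon_nonneg {W : Type*} [Monoid W] {x : MonoidAlgebra ℝ W} (hx : IsLaw x) :
    0 ≤ shannon x :=
  Finset.sum_nonneg fun a _ => Real.negMulLog_nonneg (hx.nonneg a) (hx.coeff_le_one a)

theorem shannon_mul_le {W : Type*} [Monoid W] {x y : MonoidAlgebra ℝ W} (hx : IsLaw x)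
    (hy : IsLaw y) : shannon (x * y) ≤ shannon x + shannon y := by
  have h := shannon_sum_single_le (x.coeff.support ×ˢ y.coeff.support) (fun i => i.1 * i.2)
    (w := fun i => x.coeff i.1 * y.coeff i.2) fun i _ => mul_nonneg (hx.nonneg _) (hy.nonneg _)
  rwa [sum_negMulLog_mul, ← mul_eq_sum_single, hx.mass_eq, hy.mass_eq, one_mul, one_mul] at h

/-- The entropy of the product of independent random elements is the sum of the entropies if the
product determines the factors. -/
theorem shannon_mul {W : Type*} [Monoid W] {x y : MonoidAlgebra ℝ W} (hx : IsLaw x)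
    (hy : IsLaw y)
    (h : Set.InjOn (fun i : W × W => i.1 * i.2) (x.coeff.support ×ˢ y.coeff.support)) :
    shannon (x * y) = shannon x + shannon y := by
  rw [mul_eq_sum_single, shannon_sum_single _ _ _ (by simpa using h), sum_negMulLog_mul,
    hx.mass_eq, hy.mass_eq, one_mul, one_mul]

theorem shannon_single {W : Type*} (a : W) : shannon (MonoidAlgebra.single a (1 : ℝ)) = 0 := by
  rw [shannon, MonoidAlgebra.coeff_single, Finsupp.sum_single_index] <;> simp

theorem shannon_mul_single {W : Type*} [Group W] {x : MonoidAlgebra ℝ W} (hx : IsLaw x) (a : W) :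
    shannon (x * MonoidAlgebra.single a 1) = shannon x := by
  rw [shannon_mul hx (isLaw_single a), shannon_single, add_zero]
  rintro ⟨b, c⟩ h ⟨b', c'⟩ h' e
  have hc : c = a := by
    by_contra hne
    exact (Finsupp.mem_support_iff.1 h.2) (by simp [Ne.symm hne])
  have hc' : c' = a := by
    by_contra hne
    exact (Finsupp.mem_support_iff.1 h'.2) (by simp [Ne.symm hne])
  subst hc hc'
  simpa using e

/-- Concavity of the entropy. -/
theorem sum_mul_shannon_le {W : Type*} {ι : Type*} (I : Finset ι) {w : ι → ℝ}
    {f : ι → MonoidAlgebra ℝ W} (hw : ∀ i ∈ I, 0 ≤ w i) (hw1 : ∑ i ∈ I, w i = 1)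
    (hf : ∀ i ∈ I, ∀ a, 0 ≤ (f i).coeff a) :
    ∑ i ∈ I, w i * shannon (f i) ≤ shannon (∑ i ∈ I, w i • f i) := by
  classical
  set t := (I.biUnion fun i => (f i).coeff.support) ∪ (∑ i ∈ I, w i • f i).coeff.support
  rw [shannon_eq_sum (t := t) _ Finset.subset_union_right]
  have : ∀ i ∈ I, w i * shannon (f i) = ∑ a ∈ t, w i * Real.negMulLog ((f i).coeff a) := by
    intro i hi
    rw [shannon_eq_sum (t := t), Finset.mul_sum]
    exact (Finset.subset_biUnion_of_mem (fun i => (f i).coeff.support) hi).trans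
      Finset.subset_union_left
  rw [Finset.sum_congr rfl this, Finset.sum_comm]
  refine Finset.sum_le_sum fun a _ => ?_
  have := Real.concaveOn_negMulLog.le_map_sum (t := I) (w := w) (p := fun i => (f i).coeff a) hw hw1
    fun i hi => hf i hi a
  simpa [MonoidAlgebra.coeff_sum, Finsupp.finsetSum_apply] using this

/-- The law `x * y` is a mixture of right translates of `x`. Translates have the same entropy as
`x`, and concavity does the rest. -/
theorem shannon_le_shannon_mul {W : Type*} [Group W] {x y : MonoidAlgebra ℝ W} (hx : IsLaw x)
    (hy : IsLaw y) : shannon x ≤ shannon (x * y) := by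
  have h1 : ∑ b ∈ y.coeff.support, y.coeff b = 1 := by rw [← mass_eq_sum, hy.mass_eq]
  have h := sum_mul_shannon_le y.coeff.support (w := y.coeff)
    (f := fun b => x * MonoidAlgebra.single b 1) (fun b _ => hy.nonneg b) h1
    fun b _ => (hx.mul (isLaw_single b)).nonneg
  rw [← mul_eq_sum_smul] at h
  simpa [shannon_mul_single hx, ← Finset.sum_mul, h1] using h

/-! ### Entropy along convolution powers -/

theorem shannon_pow_mono {W : Type*} [Group W] {x : MonoidAlgebra ℝ W} (hx : IsLaw x) :
    Monotone fun n : ℕ => shannon (x ^ n) := by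
  refine monotone_nat_of_le_succ fun n => ?_
  rw [pow_succ]
  exact shannon_le_shannon_mul (hx.pow n) hx

theorem shannon_pow_mul_le {W : Type*} [Monoid W] {x : MonoidAlgebra ℝ W} (hx : IsLaw x)
    (m k : ℕ) : shannon (x ^ (m * k)) ≤ k * shannon (x ^ m) := by
  induction k with
  | zero => simp [MonoidAlgebra.one_def, shannon_single]
  | succ k ih =>
    rw [Nat.mul_succ, pow_add]
    push_cast
    linarith [shannon_mul_le (hx.pow (m * k)) (hx.pow m)]

/-- A quadratic lower bound for the entropies of the powers of a law. -/
theorem le_shannon_pow {W : Type*} [Group W] {x : MonoidAlgebra ℝ W} (hx : IsLaw x)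
    {M : ℕ} (hM : 0 < M) (m : ℕ) :
    shannon (x ^ M) / (2 * M) * (m - (m : ℝ) ^ 2 / M) ≤ shannon (x ^ m) := by
  have hM' : (0 : ℝ) < M := by exact_mod_cast hM
  have h0 := (hx.pow M).shannon_nonneg
  have hm0 := (hx.pow m).shannon_nonneg
  rcases Nat.eq_zero_or_pos m with rfl | hm
  · simpa using hm0
  have hm' : (0 : ℝ) < m := by exact_mod_cast hm
  rcases le_or_gt m M with hmM | hmM
  -- Cover `M` by `⌊M/m⌋ + 1 ≤ 2M/m` blocks of length `m`; this is the source of the factor 2.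
  · have hle : M ≤ m * (M / m + 1) := by
      have := Nat.div_add_mod M m
      have := Nat.mod_lt M hm
      rw [Nat.mul_add]; omega
    have h1 : shannon (x ^ M) ≤ ((M / m + 1 : ℕ) : ℝ) * shannon (x ^ m) :=
      (shannon_pow_mono hx hle).trans (shannon_pow_mul_le hx _ _)
    have h2 : ((M / m + 1 : ℕ) : ℝ) ≤ 2 * (M / m) := by
      have h3 : ((M / m : ℕ) : ℝ) ≤ M / m := Nat.cast_div_le
      have h4 : (1 : ℝ) ≤ M / m := by
        rw [one_le_div hm']; exact_mod_cast hmM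
      push_cast; linarith
    have h5 : shannon (x ^ M) ≤ 2 * (M / m) * shannon (x ^ m) :=
      h1.trans (mul_le_mul_of_nonneg_right h2 hm0)
    calc shannon (x ^ M) / (2 * M) * (m - (m : ℝ) ^ 2 / M)
        ≤ shannon (x ^ M) / (2 * M) * m := by
          apply mul_le_mul_of_nonneg_left _ (by positivity)
          have : 0 ≤ (m : ℝ) ^ 2 / M := by positivity
          linarith
      _ ≤ 2 * (M / m) * shannon (x ^ m) / (2 * M) * m := by gcongr
      _ = shannon (x ^ m) := by field_simp
  -- For `m > M` the quadratic term dominates and the left side is nonpositive.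
  · refine le_trans (mul_nonpos_of_nonneg_of_nonpos (by positivity) ?_) hm0
    rw [sub_nonpos, le_div_iff₀ hM', sq]
    have : (M : ℝ) ≤ m := by exact_mod_cast hmM.le
    gcongr

/-! ### Finite expectations over words of independent letters -/

/-- The expectation of `F (a₁, …, aₙ)`, where the `aᵢ` are independent with values in the finite
set `K` and weights `w`. -/
def expect {A V : Type*} [AddCommMonoid V] [Module ℝ V] (w : A → ℝ) (K : Finset A) :
    ℕ → (List A → V) → V
  | 0, F => F []
  | n + 1, F => ∑ a ∈ K, w a • expect w K n fun u => F (a :: u)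

section expect

variable {A V V' : Type*} [AddCommMonoid V] [Module ℝ V] [AddCommMonoid V'] [Module ℝ V']
  {w : A → ℝ} {K : Finset A}

theorem expect_succ (n : ℕ) (F : List A → V) :
    expect w K (n + 1) F = ∑ a ∈ K, w a • expect w K n fun u => F (a :: u) := rfl

theorem map_expect (f : V →ₗ[ℝ] V') (n : ℕ) (F : List A → V) :
    f (expect w K n F) = expect w K n fun u => f (F u) := by
  induction n generalizing F with
  | zero => rfl
  | succ n ih => simp [expect_succ, map_sum, ih]

theorem expect_add (n : ℕ) (F F' : List A → V) :
    expect w K n (fun u => F u + F' u) = expect w K n F + expect w K n F' := by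
  induction n generalizing F F' with
  | zero => rfl
  | succ n ih => simp [expect_succ, ih, Finset.sum_add_distrib]

theorem expect_const (hw : ∑ a ∈ K, w a = 1) (n : ℕ) (x : V) :
    expect w K n (fun _ => x) = x := by
  induction n with
  | zero => rfl
  | succ n ih => simp [expect_succ, ih, ← Finset.sum_smul, hw]

theorem expect_mul_left (c : ℝ) (n : ℕ) (F : List A → ℝ) :
    expect w K n (fun u => c * F u) = c * expect w K n F :=
  (map_expect (c • LinearMap.id (R := ℝ) (M := ℝ)) n F).symm

theorem expect_mono_of_length (hw : ∀ a ∈ K, 0 ≤ w a) (n : ℕ) {F F' : List A → ℝ}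
    (h : ∀ u, u.length = n → F u ≤ F' u) : expect w K n F ≤ expect w K n F' := by
  induction n generalizing F F' with
  | zero => exact h [] rfl
  | succ n ih =>
    exact Finset.sum_le_sum fun a ha =>
      mul_le_mul_of_nonneg_left (ih fun u hu => h _ (by simp [hu])) (hw a ha)

/-- The definition peels off the first letter; the comparison with the product measure in
`iid_real_setOf` peels off the last. -/
theorem expect_snoc (n : ℕ) (F : List A → V) :
    expect w K (n + 1) F = ∑ a ∈ K, w a • expect w K n fun u => F (u ++ [a]) := by
  induction n generalizing F with
  | zero => rfl
  | succ n ih =>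
    rw [expect_succ, Finset.sum_congr rfl fun a _ => congrArg (w a • ·) (ih fun u => F (a :: u))]
    simp_rw [expect_succ, Finset.smul_sum]
    rw [Finset.sum_comm]
    exact Finset.sum_congr rfl fun a _ => Finset.sum_congr rfl fun b _ => smul_comm _ _ _

/-- Read from right to left, this disintegrates the law of a walk over the words of its steps. -/
theorem expect_list_prod {R : Type*} [Ring R] [Algebra ℝ R] (φ : A → R) (n : ℕ) :
    expect w K n (fun u => (u.map φ).prod) = (∑ a ∈ K, w a • φ a) ^ n := by
  induction n with
  | zero => rw [pow_zero]; rfl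
  | succ n ih =>
    rw [expect_succ, pow_succ', ← ih, Finset.sum_mul]
    refine Finset.sum_congr rfl fun a _ => ?_
    rw [smul_mul_assoc, ← LinearMap.mulLeft_apply (R := ℝ), map_expect]
    simp

theorem isLaw_expect {W : Type*} [Monoid W] (hw : ∀ a ∈ K, 0 ≤ w a) (hw1 : ∑ a ∈ K, w a = 1)
    (n : ℕ) {F : List A → MonoidAlgebra ℝ W} (hF : ∀ u, IsLaw (F u)) :
    IsLaw (expect w K n F) := by
  induction n generalizing F with
  | zero => exact hF []
  | succ n ih => exact isLaw_sum _ hw hw1 fun a _ => ih fun u => hF _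

theorem expect_shannon_le {W : Type*} [Monoid W] (hw : ∀ a ∈ K, 0 ≤ w a) (hw1 : ∑ a ∈ K, w a = 1)
    (n : ℕ) {F : List A → MonoidAlgebra ℝ W} (hF : ∀ u, IsLaw (F u)) :
    expect w K n (fun u => shannon (F u)) ≤ shannon (expect w K n F) := by
  induction n generalizing F with
  | zero => exact le_rfl
  | succ n ih =>
    refine (Finset.sum_le_sum fun a ha => mul_le_mul_of_nonneg_left
      (ih fun u => hF (a :: u)) (hw a ha)).trans ?_
    exact sum_mul_shannon_le K hw hw1 fun a _ =>
      (isLaw_expect hw hw1 n fun u => hF (a :: u)).nonneg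

end expect

/-! ### From the infinite product measure to finite expectations -/

theorem walk_eq_prod {A : Type*} [Monoid A] (x : ℕ → A) (n : ℕ) :
    walk x n = ((List.range n).map x).prod := by
  induction n with
  | zero => rfl
  | succ n ih => rw [walk, ih, List.range_succ]; simp

theorem countable_of_group_fg (Γ : Type*) [Group Γ] [h : Group.FG Γ] : Countable Γ := by
  obtain ⟨s, hs⟩ := h.out
  have : Function.Surjective (FreeGroup.lift ((↑) : s → Γ)) := by
    rw [← MonoidHom.range_eq_top, FreeGroup.range_lift_eq_closure]
    simpa using hs
  exact this.countable

section iid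

variable {A B : Type*} [MeasurableSpace A]

instance (ρ : Measure A) [IsProbabilityMeasure ρ] : IsProbabilityMeasure (iid ρ) :=
  inferInstanceAs (IsProbabilityMeasure (Measure.infinitePi fun _ : ℕ => ρ))

theorem iid_real_eval (ρ : Measure A) [IsProbabilityMeasure ρ] (n : ℕ) {s : Set A}
    (hs : MeasurableSet s) : (iid ρ).real {ω | ω n ∈ s} = ρ.real s := by
  have := (measurePreserving_eval_infinitePi (fun _ : ℕ => ρ) n).measureReal_preimage
    hs.nullMeasurableSet
  exact this

theorem iid_real_inter (ρ : Measure A) [IsProbabilityMeasure ρ] [Countable A]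
    [MeasurableSingletonClass A] (φ : A → B) (n : ℕ) (Q : List B → Prop) (s : Set A) :
    (iid ρ).real ({ω | Q ((List.range n).map fun i => φ (ω i))} ∩ {ω | ω n ∈ s}) =
      (iid ρ).real {ω | Q ((List.range n).map fun i => φ (ω i))} * ρ.real s := by
  have hind := (ProbabilityTheory.iIndepFun_infinitePi (P := fun _ : ℕ => ρ)
    (X := fun _ => id) fun _ => measurable_id).indepFun_finset (Finset.range n) {n} (by simp)
    fun i => measurable_pi_apply i
  -- A filler for indices outside `range n`, which the event never reads.
  let a₀ : A := (nonempty_of_isProbabilityMeasure ρ).some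
  let D : Set (Finset.range n → A) := {x | Q ((List.range n).map fun i =>
    φ (if h : i ∈ Finset.range n then x ⟨i, h⟩ else a₀))}
  let E : Set (({n} : Finset ℕ) → A) := {x | x ⟨n, by simp⟩ ∈ s}
  have h := hind.measure_inter_preimage_eq_mul D E (Set.to_countable _).measurableSet
    (Set.to_countable _).measurableSet
  have hD : (fun (ω : ℕ → A) (i : Finset.range n) => id (ω i)) ⁻¹' D =
      {ω | Q ((List.range n).map fun i => φ (ω i))} := by
    ext ω
    have : (List.range n).map (fun i => φ (if h : i ∈ Finset.range n then ω i else a₀)) =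
        (List.range n).map fun i => φ (ω i) := by
      refine List.map_congr_left fun i hi => ?_
      rw [dif_pos (by simpa using hi)]
    simp only [D, Set.mem_preimage, Set.mem_ofPred_eq, id]
    rw [this]
  have hE : (fun (ω : ℕ → A) (i : ({n} : Finset ℕ)) => id (ω i)) ⁻¹' E = {ω | ω n ∈ s} := rfl
  rw [hD, hE] at h
  rw [← iid_real_eval ρ n (Set.to_countable s).measurableSet, measureReal_def, measureReal_def,
    measureReal_def, ← ENNReal.toReal_mul]
  exact congrArg _ h

open Classical in
/-- The probability of an event determined by the first `n` steps of a sequence of independent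
random elements with finitely many values. -/
theorem iid_real_setOf (ρ : Measure A) [IsProbabilityMeasure ρ] [Countable A]
    [MeasurableSingletonClass A] (φ : A → B) (K : Finset B) (hK : ρ.real (φ ⁻¹' K) = 1) (n : ℕ)
    (Q : List B → Prop) :
    (iid ρ).real {ω | Q ((List.range n).map fun i => φ (ω i))} =
      expect (fun b => ρ.real (φ ⁻¹' {b})) K n fun u => if Q u then (1 : ℝ) else 0 := by
  induction n generalizing Q with
  | zero =>
    by_cases h : Q [] <;> simp [expect, h]
  | succ n ih =>
    have hm : ∀ s : Set A, MeasurableSet s := fun s => (Set.to_countable s).measurableSet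
    have hmn : ∀ s : Set A, MeasurableSet {ω : ℕ → A | ω n ∈ s} := fun s =>
      measurable_pi_apply n (hm s)
    rw [expect_snoc]
    simp_rw [← ih]
    set S := {ω : ℕ → A | Q ((List.range (n + 1)).map fun i => φ (ω i))} with hS
    -- Up to a null set the last letter lies in `K`, so the event splits into finitely many disjoint
    -- pieces according to that letter.
    have h1 : (iid ρ).real S = (iid ρ).real (S ∩ {ω | ω n ∈ φ ⁻¹' K}) := by
      have hc : (iid ρ).real {ω | ω n ∈ φ ⁻¹' (K : Set B)}ᶜ = 0 := by
        rw [probReal_compl_eq_one_sub (hmn _), iid_real_eval ρ n (hm _), hK, sub_self]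
      rw [← measureReal_inter_add_sdiff (s := S) (hmn (φ ⁻¹' (K : Set B)))]
      rw [measureReal_mono_null (s₁ := S \ {ω | ω n ∈ φ ⁻¹' (K : Set B)}) (fun ω hω => hω.2) hc]
      rw [add_zero]
    have h2 : S ∩ {ω | ω n ∈ φ ⁻¹' (K : Set B)} =
        ⋃ b ∈ K, ({ω | Q (((List.range n).map fun i => φ (ω i)) ++ [b])} ∩
          {ω | ω n ∈ φ ⁻¹' {b}}) := by
      ext ω
      simp only [hS, List.range_succ, List.map_append, List.map_cons, List.map_nil, Set.mem_inter_iff,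
        Set.mem_ofPred_eq, Set.mem_preimage, Finset.mem_coe, Set.mem_iUnion, Set.mem_singleton_iff,
        exists_prop]
      constructor
      · rintro ⟨h, hb⟩
        exact ⟨_, hb, h, rfl⟩
      · rintro ⟨b, hb, h, rfl⟩
        exact ⟨h, hb⟩
    have hmeas : ∀ Q : List B → Prop,
        MeasurableSet {ω : ℕ → A | Q ((List.range n).map fun i => φ (ω i))} := by
      intro Q
      have : Measurable fun (ω : ℕ → A) (i : Fin n) => ω i :=
        measurable_pi_lambda _ fun i => measurable_pi_apply _
      have h := this (t := {x : Fin n → A | Q (List.ofFn fun i => φ (x i))})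
        (Set.to_countable _).measurableSet
      convert h using 2
      ext ω
      rw [Set.mem_preimage, Set.mem_ofPred_eq, Set.mem_ofPred_eq, List.ofFn_eq_map]
      rw [← List.map_coe_finRange_eq_range, List.map_map]
      rfl
    rw [h1, h2, measureReal_biUnion_finset]
    · refine Finset.sum_congr rfl fun b _ => ?_
      rw [iid_real_inter ρ φ n (fun u => Q (u ++ [b])), smul_eq_mul, mul_comm]
    · intro b _ b' _ hbb'
      refine Set.disjoint_left.2 fun ω h h' => hbb' ?_
      exact h.2.symm.trans h'.2
    · intro b _
      exact (hmeas fun u => Q (u ++ [b])).inter (hmn _)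

end iid

/-! ### Coincidences among switch positions and visits to the root -/

open Classical in
/-- The number of pairs of equal entries of a list. -/
def collisions {S : Type*} (L : List S) : ℕ := (L.map fun s => L.count s).sum

open Classical in
theorem collisions_cons {S : Type*} (a : S) (L : List S) :
    collisions (a :: L) = 1 + 2 * L.count a + collisions L := by
  have h : ∀ L' : List S, (L'.map fun s => (a :: L).count s).sum =
      (L'.map fun s => L.count s).sum + L'.count a := by
    intro L'
    induction L' with
    | nil => rfl
    | cons b L' ih =>
      rw [List.map_cons, List.sum_cons, ih, List.map_cons, List.sum_cons, List.count_cons,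
        List.count_cons]
      simp only [beq_iff_eq, eq_comm (a := a)]
      ring
  rw [collisions, h, List.map_cons, List.sum_cons, List.count_cons_self, collisions]
  ring

section visits

variable {Γ S : Type*} [Group Γ] [MulAction Γᵐᵒᵖ S]

open Classical in
/-- The number of visits to `o` up to time `n`, in expectation, of the walk started at `a`. -/
def meanVisits (w : Γ → ℝ) (K : Finset Γ) (o : S) : ℕ → S → ℝ
  | 0, a => if a = o then 1 else 0
  | n + 1, a => (if a = o then 1 else 0) + ∑ g ∈ K, w g * meanVisits w K o n (a <• g)

/-- The walk with steps `u` started at the given point does not visit `o`. -/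
def Avoids (o : S) : S → List Γ → Prop
  | a, [] => a ≠ o
  | a, g :: u => a ≠ o ∧ Avoids o (a <• g) u

theorem avoids_iff (o a : S) (u : List Γ) :
    Avoids o a u ↔ ∀ k ≤ u.length, a <• (u.take k).prod ≠ o := by
  induction u generalizing a with
  | nil => simp [Avoids]
  | cons g u ih =>
    rw [Avoids, ih]
    constructor
    · rintro ⟨h0, h⟩ k hk
      cases k with
      | zero => simpa using h0
      | succ k => simpa [mul_smul] using h k (by simpa using hk)
    · intro h
      refine ⟨by simpa using h 0 (by simp), fun k hk => ?_⟩
      simpa [mul_smul] using h (k + 1) (by simpa using hk)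

open Classical in
/-- The probability that the walk started at `a` does not visit `o` up to time `n`. -/
def avoidProb (w : Γ → ℝ) (K : Finset Γ) (o : S) (n : ℕ) (a : S) : ℝ :=
  expect w K n fun u => if Avoids o a u then 1 else 0

variable {w : Γ → ℝ} {K : Finset Γ} {o : S}

theorem avoidProb_zero_of_ne {a : S} (h : a ≠ o) : avoidProb w K o 0 a = 1 := by
  simp [avoidProb, expect, Avoids, h]

theorem avoidProb_self (hw1 : ∑ g ∈ K, w g = 1) (n : ℕ) : avoidProb w K o n o = 0 := by
  have : ∀ u : List Γ, ¬ Avoids o o u := by rintro (_ | _) <;> simp [Avoids]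
  simp [avoidProb, this, expect_const hw1]

theorem avoidProb_succ_of_ne {a : S} (h : a ≠ o) (n : ℕ) :
    avoidProb w K o (n + 1) a = ∑ g ∈ K, w g * avoidProb w K o n (a <• g) := by
  classical
  refine Finset.sum_congr rfl fun g _ => ?_
  rw [smul_eq_mul]
  congr 2
  funext u
  exact if_congr (and_iff_right h) rfl rfl

theorem avoidProb_succ_le (hw : ∀ g ∈ K, 0 ≤ w g) (hw1 : ∑ g ∈ K, w g = 1) (n : ℕ) (a : S) :
    avoidProb w K o (n + 1) a ≤ avoidProb w K o n a := by
  induction n generalizing a with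
  | zero =>
    by_cases h : a = o
    · rw [h, avoidProb_self hw1, avoidProb_self hw1]
    · rw [avoidProb_zero_of_ne h, ← expect_const (V := ℝ) hw1 1 (1 : ℝ)]
      refine expect_mono_of_length hw _ fun u _ => ?_
      split_ifs <;> norm_num
  | succ n ih =>
    by_cases h : a = o
    · rw [h, avoidProb_self hw1, avoidProb_self hw1]
    · rw [avoidProb_succ_of_ne h, avoidProb_succ_of_ne h]
      exact Finset.sum_le_sum fun g hg => mul_le_mul_of_nonneg_left (ih _) (hw g hg)

/-- The probability that the walk started at `o` does not return to `o` up to time `n + 1`. -/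
def escapeProb (w : Γ → ℝ) (K : Finset Γ) (o : S) (n : ℕ) : ℝ :=
  ∑ g ∈ K, w g * avoidProb w K o n (o <• g)

theorem escapeProb_antitone (hw : ∀ g ∈ K, 0 ≤ w g) (hw1 : ∑ g ∈ K, w g = 1) :
    Antitone (escapeProb w K o) :=
  antitone_nat_of_succ_le fun n => Finset.sum_le_sum fun g hg =>
    mul_le_mul_of_nonneg_left (avoidProb_succ_le hw hw1 n _) (hw g hg)

/-- The last visit to `o` occurs at most once, and every visit is the last one with probability at
least the escape probability. -/
theorem mul_meanVisits_le (hw : ∀ g ∈ K, 0 ≤ w g) (hw1 : ∑ g ∈ K, w g = 1) {N : ℕ} {p : ℝ}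
    (hp1 : p ≤ 1) (hp : p ≤ escapeProb w K o N) {n : ℕ} (hn : n ≤ N + 1) (a : S) :
    p * meanVisits w K o n a ≤ 1 - avoidProb w K o n a := by
  induction n generalizing a with
  | zero =>
    by_cases h : a = o
    · rw [h, avoidProb_self hw1]; simpa [meanVisits] using hp1
    · rw [avoidProb_zero_of_ne h]; simp [meanVisits, h]
  | succ n ih =>
    have h1 : ∑ g ∈ K, w g * (p * meanVisits w K o n (a <• g)) ≤
        ∑ g ∈ K, w g * (1 - avoidProb w K o n (a <• g)) :=
      Finset.sum_le_sum fun g hg => mul_le_mul_of_nonneg_left (ih (by omega) _) (hw g hg)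
    simp only [mul_sub, mul_one, Finset.sum_sub_distrib, hw1, mul_left_comm _ p,
      ← Finset.mul_sum] at h1
    by_cases h : a = o
    · subst h
      -- The visit at time 0 costs `p`, which is at most the probability that it is the last one;
      -- `h1` bounds the later visits by the complementary probability.
      have h2 := escapeProb_antitone (o := a) hw hw1 (show n ≤ N by omega)
      rw [avoidProb_self hw1, meanVisits, if_pos rfl]
      rw [← escapeProb] at h1
      linarith
    · rw [avoidProb_succ_of_ne h, meanVisits, if_neg h]
      linarith

/-- The positions at which the switches are made, when the walk in `Γ` has the steps `u`. -/
def sites (o : S) : List Γ → List S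
  | [] => []
  | g :: u => o :: (o :: sites o u).map (· <• g⁻¹)

theorem length_sites (o : S) (u : List Γ) : (sites o u).length = 2 * u.length := by
  induction u with
  | nil => rfl
  | cons g u ih => simp [sites, ih]; ring

open Classical in
theorem count_map_smul (g : Γ) (a : S) (L : List S) :
    (L.map (· <• g⁻¹)).count a = L.count (a <• g) := by
  have h := L.count_map_of_injective (· <• g⁻¹) (MulAction.injective (MulOpposite.op g⁻¹)) (a <• g)
  simpa [smul_smul] using h

-- Switches occur at the points `o.Y_k⁻¹`, and `o.Y_k⁻¹ = a` exactly when `a.Y_k = o`. Thus switches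
-- at `a` are visits to `o` by the walk started at `a`, and a first step `g` replaces `a` by `a.g`.
open Classical in
theorem count_sites_cons (o a : S) (g : Γ) (u : List Γ) :
    ((sites o (g :: u)).count a : ℝ) =
      (if a = o then 1 else 0) + ((if a <• g = o then 1 else 0) + (sites o u).count (a <• g)) := by
  rw [sites, List.count_cons, count_map_smul, List.count_cons]
  push_cast
  simp only [beq_iff_eq, eq_comm (a := o)]
  ring

-- A visit to `o` at an intermediate time carries two switches, one ending a step and one beginning
-- the next; a visit at time `0` or `n` carries one when `n ≥ 1`. The indicator on the left supplies
-- the missing one at time `0`, which makes the induction close.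
open Classical in
theorem expect_count_sites_add_le (hw : ∀ g ∈ K, 0 ≤ w g) (hw1 : ∑ g ∈ K, w g = 1) (n : ℕ)
    (a : S) :
    (if a = o then 1 else 0) + expect w K n (fun u => ((sites o u).count a : ℝ)) ≤
      2 * meanVisits w K o n a := by
  induction n generalizing a with
  | zero =>
    simp only [expect, sites, meanVisits, List.count_nil]
    split_ifs <;> norm_num
  | succ n ih =>
    have h1 := Finset.sum_le_sum fun g hg => mul_le_mul_of_nonneg_left (ih (a <• g)) (hw g hg)
    rw [expect_succ, meanVisits]
    simp only [count_sites_cons, expect_add, expect_const hw1, smul_eq_mul] at h1 ⊢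
    simp only [mul_add, Finset.sum_add_distrib, ← Finset.sum_mul, hw1, one_mul,
      mul_left_comm _ (2 : ℝ), ← Finset.mul_sum] at h1 ⊢
    linarith

theorem collisions_map_smul (g : Γ) (L : List S) :
    collisions (L.map (· <• g⁻¹)) = collisions L := by
  classical
  simp only [collisions, List.map_map]
  congr 1
  refine List.map_congr_left fun s _ => ?_
  simp only [Function.comp]
  convert L.count_map_of_injective (· <• g⁻¹) (MulAction.injective (MulOpposite.op g⁻¹)) s

open Classical in
theorem collisions_sites_cons (o : S) (g : Γ) (u : List Γ) :
    (collisions (sites o (g :: u)) : ℝ) =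
      2 + 2 * ((if o <• g = o then 1 else 0) + (sites o u).count (o <• g)) +
        2 * (sites o u).count o + collisions (sites o u) := by
  rw [sites, collisions_cons, collisions_map_smul, collisions_cons, count_map_smul, List.count_cons]
  push_cast
  simp only [beq_iff_eq, eq_comm (a := o)]
  ring

/-- Translation preserves coincidences, so prepending a step only adds pairs involving the two new
switches. Their mean number is at most `4 * meanVisits` over `n + 1` steps plus `4 * meanVisits`
over `n` steps, both started at `o`, and each mean is at most `1/p` when `p > 0`. This gives 8 per
step. -/
theorem mul_expect_collisions_le (hw : ∀ g ∈ K, 0 ≤ w g) (hw1 : ∑ g ∈ K, w g = 1) {N : ℕ} {p : ℝ}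
    (hp0 : 0 ≤ p) (hp1 : p ≤ 1) (hp : p ≤ escapeProb w K o N) {n : ℕ} (hn : n ≤ N + 1) :
    p * expect w K n (fun u => (collisions (sites o u) : ℝ)) ≤ 8 * n := by
  classical
  induction n with
  | zero => simp [expect, sites, collisions]
  | succ n ih =>
    have h1 := Finset.sum_le_sum fun g hg => mul_le_mul_of_nonneg_left
      (expect_count_sites_add_le (o := o) hw hw1 n (o <• g)) (hw g hg)
    have h2 := expect_count_sites_add_le (o := o) hw hw1 n o
    have h3 := mul_meanVisits_le hw hw1 hp1 hp (show n ≤ N + 1 by omega) o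
    have h4 := mul_meanVisits_le hw hw1 hp1 hp hn o
    rw [avoidProb_self hw1] at h3 h4
    rw [meanVisits, if_pos rfl] at h4
    rw [if_pos rfl] at h2
    rw [expect_succ]
    simp only [collisions_sites_cons, expect_add, expect_const hw1, smul_eq_mul,
      expect_mul_left] at h1 ⊢
    simp only [mul_add, Finset.sum_add_distrib, ← Finset.sum_mul, hw1, one_mul,
      mul_left_comm _ (2 : ℝ), ← Finset.mul_sum] at h1 h4 ⊢
    push_cast
    have h1' := mul_le_mul_of_nonneg_left h1 hp0
    have h2' := mul_le_mul_of_nonneg_left h2 hp0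
    have := ih (by omega)
    nlinarith

end visits

/-! ### Independent lamps and their entropy -/

section lamps

variable {Γ Λ S : Type*} [Group Γ] [Group Λ]

open Classical in
/-- The law of a configuration whose only nontrivial lamp is the one at `s`. -/
def lamp (s : S) : MonoidAlgebra ℝ Λ →+* MonoidAlgebra ℝ (S → Λ) :=
  MonoidAlgebra.mapDomainRingHom ℝ (MonoidHom.mulSingle (fun _ : S => Λ) s)

open Classical in
theorem lamp_apply (s : S) (x : MonoidAlgebra ℝ Λ) :
    lamp s x = x.mapDomain (Pi.mulSingle (M := fun _ : S => Λ) s) := rfl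

theorem lamp_single (s : S) (l : Λ) (r : ℝ) :
    lamp s (MonoidAlgebra.single l r) =
      MonoidAlgebra.single (open Classical in Pi.mulSingle (M := fun _ : S => Λ) s l) r := by
  rw [lamp_apply, MonoidAlgebra.mapDomain_single]

theorem isLaw_lamp (s : S) {x : MonoidAlgebra ℝ Λ} (hx : IsLaw x) : IsLaw (lamp s x) :=
  hx.mapDomain _

theorem shannon_lamp (s : S) (x : MonoidAlgebra ℝ Λ) : shannon (lamp s x) = shannon x := by
  classical
  rw [lamp_apply]
  convert shannon_mapDomain (Pi.mulSingle_injective (M := fun _ : S => Λ) s) x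

theorem commute_lamp {s t : S} (h : s ≠ t) (x y : MonoidAlgebra ℝ Λ) :
    Commute (lamp s x) (lamp t y) := by
  rw [eq_sum_single x, eq_sum_single y, map_sum, map_sum]
  refine Commute.sum_left _ _ _ fun a _ => Commute.sum_right _ _ _ fun b _ => ?_
  classical
  rw [lamp_single, lamp_single]
  refine MonoidAlgebra.single_commute_single ?_ (Commute.all _ _)
  convert Pi.mulSingle_commute (f := fun _ : S => Λ) h a b

/-- Configurations that are trivial at `s`. -/
def TrivialAt (s : S) (x : MonoidAlgebra ℝ (S → Λ)) : Prop :=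
  ∀ ℓ ∈ x.coeff.support, ℓ s = 1

theorem trivialAt_lamp {s t : S} (h : t ≠ s) (x : MonoidAlgebra ℝ Λ) :
    TrivialAt s (lamp t x) := by
  classical
  intro ℓ hℓ
  obtain ⟨l, -, rfl⟩ := Finset.mem_image.1 (Finsupp.mapDomain_support hℓ)
  simp [Pi.mulSingle_eq_of_ne' h]

theorem TrivialAt.mul {s : S} {x y : MonoidAlgebra ℝ (S → Λ)} (hx : TrivialAt s x)
    (hy : TrivialAt s y) : TrivialAt s (x * y) := by
  classical
  intro ℓ hℓ
  rw [mul_eq_sum_single] at hℓ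
  obtain ⟨i, hi, rfl⟩ := Finset.mem_image.1 (support_sum_single_subset _ _ _ hℓ)
  rw [Finset.mem_product] at hi
  simp [hx _ hi.1, hy _ hi.2]

theorem trivialAt_one (s : S) : TrivialAt s (1 : MonoidAlgebra ℝ (S → Λ)) := by
  classical
  intro ℓ hℓ
  by_contra hne
  refine Finsupp.mem_support_iff.1 hℓ ?_
  rw [MonoidAlgebra.one_def, MonoidAlgebra.coeff_single, Finsupp.single_apply, if_neg]
  rintro rfl
  exact hne rfl

theorem trivialAt_list_prod (s : S) (x : MonoidAlgebra ℝ Λ) {L : List S} (hL : s ∉ L) :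
    TrivialAt s (L.map fun t => lamp t x).prod := by
  induction L with
  | nil => exact trivialAt_one s
  | cons t L ih =>
    rw [List.mem_cons, not_or] at hL
    rw [List.map_cons, List.prod_cons]
    exact (trivialAt_lamp (Ne.symm hL.1) x).mul (ih hL.2)

/-- The value of the product at `s` reveals the second factor, and cancellation then reveals the
first, so the entropies add. -/
theorem shannon_mul_lamp {s : S} {x : MonoidAlgebra ℝ (S → Λ)} {y : MonoidAlgebra ℝ Λ}
    (hx : IsLaw x) (hy : IsLaw y) (h : TrivialAt s x) :
    shannon (x * lamp s y) = shannon x + shannon y := by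
  classical
  rw [shannon_mul hx (isLaw_lamp s hy), shannon_lamp]
  rintro ⟨a, b⟩ ⟨ha, hb⟩ ⟨a', b'⟩ ⟨ha', hb'⟩ e
  obtain ⟨l, -, rfl⟩ := Finset.mem_image.1 (Finsupp.mapDomain_support hb)
  obtain ⟨l', -, rfl⟩ := Finset.mem_image.1 (Finsupp.mapDomain_support hb')
  have e' : a * Pi.mulSingle s l = a' * Pi.mulSingle s l' := e
  have hl : l = l' := by
    have := congrFun e' s
    have h1 := h a ha
    have h2 := h a' ha'
    simpa [h1, h2] using this
  subst hl
  have ha : a = a' := mul_right_cancel e'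
  subst ha
  rfl

-- Lamps at different sites commute, so all switches at `s` can be collected at the right end, where
-- they form a convolution power.
open Classical in
theorem list_prod_lamp (s : S) (x : MonoidAlgebra ℝ Λ) (L : List S) :
    (L.map fun t => lamp t x).prod =
      ((L.filter (· ≠ s)).map fun t => lamp t x).prod * lamp s (x ^ L.count s) := by
  induction L with
  | nil => simp
  | cons t L ih =>
    rw [List.map_cons, List.prod_cons, ih]
    by_cases h : t = s
    · subst h
      have hc : Commute (lamp t x) (((L.filter (· ≠ t)).map fun t => lamp t x).prod) := by
        refine Commute.list_prod_right _ _ fun y hy => ?_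
        obtain ⟨r, hr, rfl⟩ := List.mem_map.1 hy
        refine commute_lamp ?_ x x
        exact Ne.symm (by simpa using (List.mem_filter.1 hr).2)
      rw [List.filter_cons_of_neg (by simp), List.count_cons_self, ← mul_assoc, hc.eq, mul_assoc,
        pow_succ', map_mul]
    · rw [List.filter_cons_of_pos (by simpa using h), List.count_cons_of_ne h, List.map_cons,
        List.prod_cons, mul_assoc]

open Classical in
/-- The lamps at distinct sites are independent. -/
theorem shannon_list_prod_lamp {x : MonoidAlgebra ℝ Λ} (hx : IsLaw x) (V : Finset S) (L : List S)
    (hL : ∀ s ∈ L, s ∈ V) :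
    shannon (L.map fun t => lamp t x).prod = ∑ s ∈ V, shannon (x ^ L.count s) := by
  induction V using Finset.induction_on generalizing L with
  | empty =>
    have : L = [] := List.eq_nil_iff_forall_not_mem.2 fun s hs => by simpa using hL s hs
    simp [this, MonoidAlgebra.one_def, shannon_single]
  | insert s V hs ih =>
    rw [list_prod_lamp s, shannon_mul_lamp, ih, Finset.sum_insert hs, add_comm]
    · congr 1
      refine Finset.sum_congr rfl fun t ht => ?_
      rw [List.count_filter]
      simpa using fun h : t = s => hs (h ▸ ht)
    · intro t ht
      rw [List.mem_filter] at ht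
      have h1 := hL t ht.1
      have h2 : t ≠ s := by simpa using ht.2
      exact (Finset.mem_insert.1 h1).resolve_left h2
    · refine isLaw_list_prod fun y hy => ?_
      obtain ⟨r, -, rfl⟩ := List.mem_map.1 hy
      exact isLaw_lamp r hx
    · exact hx.pow _
    · exact trivialAt_list_prod s x (by simp)

/-- Apply `le_shannon_pow` at each site: the counts sum to the length of `L`, their squares to
`collisions L`. -/
theorem le_shannon_list_prod_lamp {x : MonoidAlgebra ℝ Λ} (hx : IsLaw x) {M : ℕ} (hM : 0 < M)
    (L : List S) :
    shannon (x ^ M) / (2 * M) * (L.length - (collisions L : ℝ) / M) ≤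
      shannon (L.map fun t => lamp t x).prod := by
  classical
  rw [shannon_list_prod_lamp hx L.toFinset L fun s hs => List.mem_toFinset.2 hs]
  refine le_trans (le_of_eq ?_) (Finset.sum_le_sum fun s _ => le_shannon_pow hx hM (L.count s))
  rw [← Finset.mul_sum, Finset.sum_sub_distrib, ← Finset.sum_div]
  congr 2
  · rw [← List.sum_toFinset_count_eq_length]; push_cast; rfl
  · rw [collisions, Finset.sum_list_map_count]
    push_cast
    congr 1
    refine Finset.sum_congr rfl fun s _ => ?_
    rw [smul_eq_mul]; push_cast; ring

/-! ### The wreath product and the walk given its path in `Γ` -/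

variable [MulAction Γᵐᵒᵖ S]

variable (Γ) in
/-- The law of a configuration as a law on the wreath product. -/
def config : MonoidAlgebra ℝ (S → Λ) →+* MonoidAlgebra ℝ (PermWreath Γ Λ S) :=
  MonoidAlgebra.mapDomainRingHom ℝ (SemidirectProduct.inl (φ := permute Γ Λ S))

theorem config_single (ℓ : S → Λ) (r : ℝ) :
    config Γ (MonoidAlgebra.single ℓ r) = MonoidAlgebra.single (SemidirectProduct.inl ℓ) r :=
  MonoidAlgebra.mapDomain_single

theorem switch_eq (o : S) (l : Λ) :
    (switch o l : PermWreath Γ Λ S) =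
      SemidirectProduct.inl (open Classical in Pi.mulSingle (M := fun _ : S => Λ) o l) := by
  classical
  ext s
  · simp [switch, Pi.mulSingle_apply]
  · rfl

theorem move_eq (g : Γ) : (move g : PermWreath Γ Λ S) = SemidirectProduct.inr g := rfl

theorem permute_mulSingle (g : Γ) (s : S) (l : Λ) :
    permute Γ Λ S g (open Classical in Pi.mulSingle s l) =
      (open Classical in Pi.mulSingle (s <• g⁻¹) l) := by
  classical
  funext t
  change (Pi.mulSingle s l : S → Λ) (t <• g) = (Pi.mulSingle (s <• g⁻¹) l : S → Λ) t
  rw [Pi.mulSingle_apply, Pi.mulSingle_apply]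
  congr 1
  rw [MulOpposite.op_inv, eq_inv_smul_iff]

/-- Conjugation by `g` carries a lamp at `s` to `s.g⁻¹`; this is the reason for the inverses in
`sites`. -/
theorem move_mul_config_lamp (g : Γ) (s : S) (x : MonoidAlgebra ℝ Λ) :
    MonoidAlgebra.single (move g : PermWreath Γ Λ S) (1 : ℝ) * config Γ (lamp s x) =
      config Γ (lamp (s <• g⁻¹) x) * MonoidAlgebra.single (move g) 1 := by
  rw [eq_sum_single x]
  simp only [map_sum, Finset.mul_sum, Finset.sum_mul, lamp_single, config_single,
    MonoidAlgebra.single_mul_single, one_mul, mul_one]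
  refine Finset.sum_congr rfl fun l _ => ?_
  rw [← permute_mulSingle, SemidirectProduct.inl_aut, move_eq]
  simp

theorem move_mul_config_list_prod (g : Γ) (L : List S) (x : MonoidAlgebra ℝ Λ) :
    MonoidAlgebra.single (move g : PermWreath Γ Λ S) (1 : ℝ) *
        config Γ (L.map fun t => lamp t x).prod =
      config Γ ((L.map (· <• g⁻¹)).map fun t => lamp t x).prod *
        MonoidAlgebra.single (move g) 1 := by
  induction L with
  | nil => simp
  | cons s L ih =>
    simp only [List.map_cons, List.prod_cons, map_mul] at ih ⊢
    rw [← mul_assoc, move_mul_config_lamp, mul_assoc, ih, mul_assoc]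

/-- The law of a step of the switch-walk-switch walk, given the step `g` in `Γ`. -/
def stepLaw (o : S) (x : MonoidAlgebra ℝ Λ) (g : Γ) : MonoidAlgebra ℝ (PermWreath Γ Λ S) :=
  config Γ (lamp o x) * MonoidAlgebra.single (move g) 1 * config Γ (lamp o x)

theorem isLaw_config {x : MonoidAlgebra ℝ (S → Λ)} (hx : IsLaw x) : IsLaw (config Γ x) :=
  hx.mapDomain _

theorem isLaw_stepLaw (o : S) {x : MonoidAlgebra ℝ Λ} (hx : IsLaw x) (g : Γ) :
    IsLaw (stepLaw o x g) :=
  ((isLaw_config (isLaw_lamp o hx)).mul (isLaw_single _)).mul (isLaw_config (isLaw_lamp o hx))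

/-- Pushing every move to the right leaves a pure lamp configuration times a deterministic group
element. -/
theorem list_prod_stepLaw (o : S) (x : MonoidAlgebra ℝ Λ) (u : List Γ) :
    (u.map (stepLaw o x)).prod =
      config Γ ((sites o u).map fun t => lamp t x).prod * MonoidAlgebra.single (move u.prod) 1 := by
  induction u with
  | nil => simp [sites, move_eq, ← MonoidAlgebra.one_def]
  | cons g u ih =>
    have h := move_mul_config_list_prod g (o :: sites o u) x
    rw [List.map_cons, List.prod_cons, map_mul] at h
    have hm : (MonoidAlgebra.single (move (g :: u).prod : PermWreath Γ Λ S) (1 : ℝ)) =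
        MonoidAlgebra.single (move g) 1 * MonoidAlgebra.single (move u.prod) 1 := by
      rw [MonoidAlgebra.single_mul_single, one_mul, move_eq, move_eq, move_eq, ← map_mul,
        List.prod_cons]
    rw [List.map_cons, List.prod_cons, ih, stepLaw, hm, sites, List.map_cons (a := o),
      List.prod_cons, map_mul, mul_assoc (_ * _), ← mul_assoc (config Γ (lamp o x)) (config Γ _),
      mul_assoc (config Γ (lamp o x)), ← mul_assoc (MonoidAlgebra.single (move g) 1), h]
    simp only [mul_assoc]

/-- Neither the fixed final move nor the injective embedding of configurations changes the entropy,
so the lamp bound applies, with two switches per step. -/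
theorem le_shannon_list_prod_stepLaw (o : S) {x : MonoidAlgebra ℝ Λ} (hx : IsLaw x) {M : ℕ}
    (hM : 0 < M) (u : List Γ) :
    shannon (x ^ M) / (2 * M) * (2 * u.length - (collisions (sites o u) : ℝ) / M) ≤
      shannon (u.map (stepLaw o x)).prod := by
  have hL : IsLaw ((sites o u).map fun t => lamp t x).prod := by
    refine isLaw_list_prod fun y hy => ?_
    obtain ⟨r, -, rfl⟩ := List.mem_map.1 hy
    exact isLaw_lamp r hx
  have h := le_shannon_list_prod_lamp hx hM (sites o u)
  rw [length_sites] at h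
  push_cast at h
  rw [list_prod_stepLaw, shannon_mul_single (isLaw_config hL)]
  exact h.trans_eq (shannon_mapDomain SemidirectProduct.inl_injective _).symm

end lamps

/-! ### Probabilities and entropies of the walks in algebraic form -/

/-- The law of the walk is a power of the law of its steps. -/
theorem iid_real_walk {A W : Type*} [MeasurableSpace A] [Countable A] [MeasurableSingletonClass A]
    [Monoid W] (ρ : Measure A) [IsProbabilityMeasure ρ] (K : Finset A) (hK : ρ.real K = 1)
    (φ : A → W) (n : ℕ) (x : W) :
    (iid ρ).real {ω | walk (fun i => φ (ω i)) n = x} =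
      ((∑ a ∈ K, MonoidAlgebra.single (φ a) (ρ.real {a})) ^ n).coeff x := by
  classical
  have h := iid_real_setOf ρ id K hK n fun u => (u.map φ).prod = x
  have h1 : ∀ ω : ℕ → A, ((List.range n).map fun i => φ (ω i)).prod = walk (fun i => φ (ω i)) n :=
    fun ω => (walk_eq_prod _ n).symm
  simp only [List.map_map, Function.comp_def, id, h1, Set.preimage_id] at h
  have h2 := expect_list_prod (w := fun a => ρ.real {a}) (K := K)
    (fun a => MonoidAlgebra.single (φ a) (1 : ℝ)) n
  simp only [MonoidAlgebra.smul_single, smul_eq_mul, mul_one] at h2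
  have h3 : ∀ u : List A, (u.map fun a => MonoidAlgebra.single (φ a) (1 : ℝ)).prod =
      MonoidAlgebra.single (u.map φ).prod 1 := by
    intro u
    induction u with
    | nil => rfl
    | cons a u ih => simp [ih, MonoidAlgebra.single_mul_single]
  -- Reading off the coefficient at `x` is linear, so it passes through the expectation and turns
  -- each point mass into an indicator.
  have h4 := map_expect (w := fun a => ρ.real {a}) (K := K)
    ({ toFun := fun y => y.coeff x, map_add' := fun _ _ => rfl, map_smul' := fun _ _ => rfl } :
      MonoidAlgebra ℝ W →ₗ[ℝ] ℝ) n
    fun u => (u.map fun a => MonoidAlgebra.single (φ a) (1 : ℝ)).prod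
  rw [h2] at h4
  rw [h]
  refine Eq.trans ?_ h4.symm
  congr 1
  funext u
  refine Eq.trans ?_ (congrArg (fun y => y.coeff x) (h3 u)).symm
  rw [MonoidAlgebra.coeff_single, Finsupp.single_apply]

theorem entropy_walk {A W : Type*} [MeasurableSpace A] [Countable A] [MeasurableSingletonClass A]
    [Monoid W] (ρ : Measure A) [IsProbabilityMeasure ρ] (K : Finset A) (hK : ρ.real K = 1)
    (φ : A → W) (n : ℕ) :
    entropy (iid ρ) (fun ω => walk (fun i => φ (ω i)) n) =
      shannon ((∑ a ∈ K, MonoidAlgebra.single (φ a) (ρ.real {a})) ^ n) := by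
  rw [shannon_eq_tsum]
  exact tsum_congr fun x => congrArg _ (iid_real_walk ρ K hK φ n x)

/-- A measure with finite support, as an element of the monoid algebra. -/
def lawOf {A : Type*} [MeasurableSpace A] (ρ : Measure A) (K : Finset A) : MonoidAlgebra ℝ A :=
  ∑ a ∈ K, MonoidAlgebra.single a (ρ.real {a})

theorem isLaw_lawOf {A : Type*} [MeasurableSpace A] [MeasurableSingletonClass A] [Monoid A]
    {ρ : Measure A} [IsProbabilityMeasure ρ] {K : Finset A} (hK : ρ.real K = 1) :
    IsLaw (lawOf ρ K) := by
  have : lawOf ρ K = ∑ a ∈ K, ρ.real {a} • MonoidAlgebra.single a (1 : ℝ) := by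
    simp [lawOf]
  rw [this]
  exact isLaw_sum _ (fun _ _ => measureReal_nonneg) (by simpa using hK) fun _ _ => isLaw_single _

theorem walkEntropy_eq {Λ : Type*} [Group Λ] [MeasurableSpace Λ] [Countable Λ]
    [MeasurableSingletonClass Λ] (ν : Measure Λ) [IsProbabilityMeasure ν] (K : Finset Λ)
    (hK : ν.real K = 1) (n : ℕ) : walkEntropy ν n = shannon (lawOf ν K ^ n) :=
  entropy_walk ν K hK id n

/-- Time 0 does not count as a return, so the first step `g` is split off; the walk restarted at
`o.g` must then avoid `o` at its times `0, …, n`. -/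
theorem lt_returnTime_iff {Γ Λ S : Type*} [Group Γ] [MulAction Γᵐᵒᵖ S] (o : S) (n : ℕ) (ω : ℕ → Λ × Γ × Λ) :
    ((n + 1 : ℕ) : ℕ∞) < returnTime (S := S) o ω ↔
      ∃ g u, (List.range (n + 1)).map (fun i => (ω i).2.1) = g :: u ∧ Avoids o (o <• g) u := by
  have h1 : ((n + 1 : ℕ) : ℕ∞) < returnTime (S := S) o ω ↔
      ∀ k ≤ n, o <• (baseWalk (k + 1) ω : Γ) ≠ o := by
    constructor
    · intro h k hk ho
      refine absurd (h.trans_le (iInf₂_le (k + 1) ⟨by omega, ho⟩)) ?_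
      rw [Nat.cast_lt]; omega
    · intro h
      have : ((n + 2 : ℕ) : ℕ∞) ≤ returnTime (S := S) o ω := by
        refine le_iInf₂ fun k hk => ?_
        rw [Nat.cast_le]
        by_contra hlt
        obtain ⟨j, rfl⟩ := Nat.exists_eq_add_of_le' hk.1
        exact h j (by omega) hk.2
      refine lt_of_lt_of_le ?_ this
      rw [Nat.cast_lt]; omega
  rw [h1]
  have h2 : (List.range (n + 1)).map (fun i => (ω i).2.1) =
      (ω 0).2.1 :: (List.range n).map fun i => (ω (i + 1)).2.1 := by
    rw [List.range_succ_eq_map, List.map_cons, List.map_map]; rfl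
  have h3 : ∀ k ≤ n, o <• (baseWalk (k + 1) ω : Γ) = (o <• (ω 0).2.1) <•
      (((List.range n).map fun i => (ω (i + 1)).2.1).take k).prod := by
    intro k hk
    rw [baseWalk, walk_eq_prod, smul_smul, ← MulOpposite.op_mul, List.range_succ_eq_map,
      ← List.map_take, List.take_range, min_eq_left hk, List.map_cons, List.map_map, List.prod_cons]
    rfl
  rw [h2]
  constructor
  · intro h
    refine ⟨_, _, rfl, ?_⟩
    rw [avoids_iff]
    intro k hk
    have hk' : k ≤ n := by simpa using hk
    rw [← h3 k hk']
    exact h k hk'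
  · rintro ⟨g, u, hgu, h⟩ k hk
    obtain ⟨rfl, rfl⟩ := List.cons.inj hgu
    rw [avoids_iff] at h
    rw [h3 k hk]
    exact h k (by simpa using hk)

theorem pathLaw_real_lt_returnTime {Γ Λ S : Type*} [Group Γ] [MeasurableSpace Γ] [Countable Γ]
    [MeasurableSingletonClass Γ] [MeasurableSpace Λ] [Countable Λ] [MeasurableSingletonClass Λ]
    [MulAction Γᵐᵒᵖ S] (o : S) (μ : Measure Γ) [IsProbabilityMeasure μ]
    (ν : Measure Λ) [IsProbabilityMeasure ν] (K : Finset Γ) (hK : μ.real K = 1) (n : ℕ) :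
    (pathLaw μ ν).real {ω | ((n + 1 : ℕ) : ℕ∞) < returnTime (S := S) o ω} =
      escapeProb (fun g => μ.real {g}) K o n := by
  classical
  have hp : ∀ s : Set Γ, (ν.prod (μ.prod ν)).real ((fun a : Λ × Γ × Λ => a.2.1) ⁻¹' s) = μ.real s := by
    intro s
    rw [show (fun a : Λ × Γ × Λ => a.2.1) ⁻¹' s = Set.univ ×ˢ s ×ˢ Set.univ by ext; simp,
      measureReal_prod_prod, measureReal_prod_prod]
    simp
  have h := iid_real_setOf (ν.prod (μ.prod ν)) (fun a => a.2.1) K (by rw [hp, hK]) (n + 1)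
    fun u => ∃ g v, u = g :: v ∧ Avoids o (o <• g) v
  simp only [← lt_returnTime_iff, hp] at h
  refine h.trans ?_
  rw [expect_succ]
  refine Finset.sum_congr rfl fun g _ => ?_
  rw [smul_eq_mul, avoidProb]
  congr 2
  funext u
  refine if_congr ⟨?_, fun h => ⟨g, u, rfl, h⟩⟩ rfl rfl
  rintro ⟨g', u', e, h⟩
  obtain ⟨rfl, rfl⟩ := List.cons.inj e
  exact h

theorem real_eq_one_of_compl {A : Type*} [MeasurableSpace A] [MeasurableSingletonClass A]
    {ρ : Measure A} [IsProbabilityMeasure ρ] {K : Finset A} (h : ρ (K : Set A)ᶜ = 0) :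
    ρ.real K = 1 := by
  have := (prob_compl_eq_zero_iff K.measurableSet).1 h
  rw [measureReal_def, this, ENNReal.toReal_one]

theorem linearInterpolation_le {f : ℕ → ℝ} (hf : Monotone f) (x : ℝ) :
    linearInterpolation f x ≤ f (⌊x⌋₊ + 1) := by
  have h1 := Nat.lt_floor_add_one x
  have h2 := hf (Nat.le_succ ⌊x⌋₊)
  rw [linearInterpolation]
  simp only [Nat.succ_eq_add_one] at h2
  nlinarith

/-! ### The entropy bound for the switch-walk-switch walk -/

section

variable {Γ Λ S : Type*} [Group Γ] [MeasurableSpace Γ] [Countable Γ] [MeasurableSingletonClass Γ]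
  [Group Λ] [MeasurableSpace Λ] [Countable Λ] [MeasurableSingletonClass Λ]
  [MulAction Γᵐᵒᵖ S]

/-- Averaging over the two switches of a step first makes its law a `μ`-mixture of the laws
`stepLaw`, whose power then expands over the paths in `Γ`. -/
theorem entropy_switchWalkSwitch (o : S) (μ : Measure Γ) [IsProbabilityMeasure μ]
    (ν : Measure Λ) [IsProbabilityMeasure ν] (K : Finset Γ) (hK : μ.real K = 1)
    (F : Finset Λ) (hF : ν.real F = 1) (n : ℕ) :
    entropy (pathLaw μ ν)
        (fun ω => (switchWalkSwitch o n ω : PermWreath Γ Λ S)) =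
      shannon ((∑ g ∈ K, μ.real {g} • stepLaw o (lawOf ν F) g) ^ n) := by
  have hKF : (ν.prod (μ.prod ν)).real (F ×ˢ K ×ˢ F : Finset (Λ × Γ × Λ)) = 1 := by
    rw [Finset.coe_product, Finset.coe_product, measureReal_prod_prod, measureReal_prod_prod, hK, hF]
    norm_num
  refine (entropy_walk (ν.prod (μ.prod ν)) _ hKF (fun a : Λ × Γ × Λ =>
    (switch o a.1 * move a.2.1 * switch o a.2.2 : PermWreath Γ Λ S)) n).trans ?_
  congr 2
  have h1 : ∀ l, config Γ (lamp o (MonoidAlgebra.single l (ν.real {l}))) =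
      MonoidAlgebra.single (switch o l : PermWreath Γ Λ S) (ν.real {l}) := by
    intro l
    rw [lamp_single, config_single, switch_eq]
  simp only [stepLaw, lawOf, map_sum, h1, Finset.sum_mul, Finset.mul_sum, Finset.smul_sum,
    MonoidAlgebra.single_mul_single, MonoidAlgebra.smul_single, smul_eq_mul, mul_one,
    Finset.sum_product]
  rw [Finset.sum_comm]
  refine Finset.sum_congr rfl fun g _ => ?_
  rw [Finset.sum_comm]
  refine Finset.sum_congr rfl fun l' _ => Finset.sum_congr rfl fun l _ => ?_
  rw [← Set.singleton_prod_singleton, ← Set.singleton_prod_singleton, measureReal_prod_prod,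
    measureReal_prod_prod]
  congr 1
  ring

theorem le_entropy_switchWalkSwitch (o : S) (μ : Measure Γ) [IsProbabilityMeasure μ]
    (ν : Measure Λ) [IsProbabilityMeasure ν] (K : Finset Γ) (hK : μ.real K = 1)
    (F : Finset Λ) (hF : ν.real F = 1) {n : ℕ} (hn : 1 ≤ n) {p : ℝ} (hp0 : 0 < p)
    (hp : p ≤ (pathLaw μ ν).real {ω | (n : ℕ∞) < returnTime (S := S) o ω}) :
    1 / 18 * (n * p * linearInterpolation (walkEntropy ν) (1 / p)) ≤
      entropy (pathLaw μ ν) (fun ω => (switchWalkSwitch o n ω : PermWreath Γ Λ S)) := by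
  obtain ⟨N, rfl⟩ := Nat.exists_eq_add_of_le' hn
  have : IsProbabilityMeasure (pathLaw μ ν) :=
    inferInstanceAs (IsProbabilityMeasure (iid (ν.prod (μ.prod ν))))
  have hp1 : p ≤ 1 := hp.trans measureReal_le_one
  rw [pathLaw_real_lt_returnTime o μ ν K hK] at hp
  have hw : ∀ g ∈ K, 0 ≤ μ.real {g} := fun _ _ => measureReal_nonneg
  have hw1 : ∑ g ∈ K, μ.real {g} = 1 := by simpa using hK
  set x := lawOf ν F
  have hx : IsLaw x := isLaw_lawOf hF
  have hmono := shannon_pow_mono hx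
  have hwe : walkEntropy ν = fun m => shannon (x ^ m) := funext fun m => walkEntropy_eq ν F hF m
  -- `M ≥ 8/p` makes the mean collision term `C / M` at most `n`, half of `2n`; rounding up costs
  -- only `Mp ≤ 8 + p ≤ 9`.
  set M := ⌈8 / p⌉₊
  have hM : 8 / p ≤ M := Nat.le_ceil _
  have hM0 : (0 : ℝ) < M := lt_of_lt_of_le (by positivity) hM
  have hMp : M * p ≤ 9 := by
    have h : (M : ℝ) < 8 / p + 1 := Nat.ceil_lt_add_one (by positivity)
    have : M * p ≤ (8 / p + 1) * p := mul_le_mul_of_nonneg_right h.le hp0.le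
    rw [add_mul, div_mul_cancel₀ _ hp0.ne'] at this
    linarith
  have hlin : linearInterpolation (walkEntropy ν) (1 / p) ≤ shannon (x ^ M) := by
    rw [hwe]
    -- It suffices that `⌊1/p⌋ + 1 ≤ 2/p ≤ M`, which uses `p ≤ 1`.
    refine (linearInterpolation_le hmono _).trans (hmono ?_)
    rw [← Nat.cast_le (α := ℝ)]
    push_cast
    have h1 := Nat.floor_le (show 0 ≤ 1 / p by positivity)
    have h2 : 1 ≤ 1 / p := by rwa [one_le_div hp0]
    have h3 : 8 / p = 8 * (1 / p) := by ring
    linarith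
  have hcoll := mul_expect_collisions_le (o := o) hw hw1 hp0.le hp1 hp le_rfl
  set C := expect (fun g => μ.real {g}) K (N + 1) (fun u => (collisions (sites o u) : ℝ))
  have hlaw : ∀ u : List Γ, IsLaw (u.map (stepLaw o x)).prod := by
    refine fun u => isLaw_list_prod fun y hy => ?_
    obtain ⟨g, -, rfl⟩ := List.mem_map.1 hy
    exact isLaw_stepLaw o hx g
  rw [entropy_switchWalkSwitch o μ ν K hK F hF, ← expect_list_prod]
  -- Conditioning on the path in `Γ` can only lower the entropy.
  refine le_trans ?_ (expect_shannon_le hw hw1 (N + 1) hlaw)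
  have h0 := (hx.pow M).shannon_nonneg
  calc 1 / 18 * (((N + 1 : ℕ) : ℝ) * p * linearInterpolation (walkEntropy ν) (1 / p))
      ≤ 1 / 18 * (((N + 1 : ℕ) : ℝ) * p * shannon (x ^ M)) := by gcongr
    _ ≤ shannon (x ^ M) / (2 * M) * ((N + 1 : ℕ) : ℝ) := by
        -- After clearing denominators this is `Mp ≤ 9`, whence `1/18`.
        rw [div_mul_eq_mul_div _ (2 * (M : ℝ)), le_div_iff₀ (by positivity)]
        have : 0 ≤ shannon (x ^ M) * ((N + 1 : ℕ) : ℝ) := by positivity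
        nlinarith [mul_le_mul_of_nonneg_right hMp this]
    _ ≤ shannon (x ^ M) / (2 * M) * (2 * ((N + 1 : ℕ) : ℝ) - C / M) := by
        apply mul_le_mul_of_nonneg_left _ (by positivity)
        have : C / M ≤ ((N + 1 : ℕ) : ℝ) := by
          rw [div_le_iff₀ hM0]
          rw [div_le_iff₀ hp0] at hM
          have hC : C ≤ 8 * ((N + 1 : ℕ) : ℝ) / p := by
            rw [le_div_iff₀ hp0]; linarith
          refine hC.trans ?_
          rw [div_le_iff₀ hp0]
          nlinarith [mul_le_mul_of_nonneg_left hM (Nat.cast_nonneg (α := ℝ) (N + 1))]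
        linarith
    _ = expect (fun g => μ.real {g}) K (N + 1) fun u => shannon (x ^ M) / (2 * M) *
          (2 * ((N + 1 : ℕ) : ℝ) - 1 / M * (collisions (sites o u) : ℝ)) := by
        have := expect_add (w := fun g => μ.real {g}) (K := K) (N + 1)
          (fun _ => 2 * ((N + 1 : ℕ) : ℝ)) fun u => -(1 / M : ℝ) * (collisions (sites o u) : ℝ)
        rw [expect_const hw1, expect_mul_left] at this
        simp only [neg_mul, ← sub_eq_add_neg] at this
        rw [expect_mul_left, this]
        ring
    _ ≤ _ := by
        refine expect_mono_of_length hw _ fun u hu => ?_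
        have := le_shannon_list_prod_stepLaw o hx (M := M) (by exact_mod_cast hM0) u
        rw [hu] at this
        rwa [one_div_mul_eq_div]

end

end SwitchWalk

end

theorem lemma5 :
    ∃ c : ℝ, 0 < c ∧
      ∀ (Γ : Type*) (Λ : Type*) (S : Type*)
        [Group Γ] [Group.FG Γ] [Infinite Γ] [MeasurableSpace Γ] [DiscreteMeasurableSpace Γ]
        [Group Λ] [Group.FG Λ] [MeasurableSpace Λ] [DiscreteMeasurableSpace Λ]
        [MulAction Γᵐᵒᵖ S] (o : S)
        (μ : Measure Γ) [IsProbabilityMeasure μ] (ν : Measure Λ) [IsProbabilityMeasure ν],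
        (∀ g : Γ, μ {g⁻¹} = μ {g}) → (∃ F : Finset Γ, μ (F : Set Γ)ᶜ = 0) →
        (∀ l : Λ, ν {l⁻¹} = ν {l}) → (∃ F : Finset Λ, ν (F : Set Λ)ᶜ = 0) →
        ∀ n : ℕ, 1 ≤ n → ∀ p : ℝ, 0 < p →
          p ≤ (SwitchWalk.pathLaw μ ν).real
            {ω | (n : ℕ∞) < SwitchWalk.returnTime (S := S) o ω} →
          c * (n * p * SwitchWalk.linearInterpolation (SwitchWalk.walkEntropy ν) (1 / p)) ≤
            SwitchWalk.entropy (SwitchWalk.pathLaw μ ν)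
              (fun ω => (SwitchWalk.switchWalkSwitch o n ω : SwitchWalk.PermWreath Γ Λ S)) := by
  refine ⟨1 / 18, by norm_num, ?_⟩
  intro Γ Λ S _ _ _ _ _ _ _ _ _ _ o μ _ ν _ _ hμ _ hν n hn p hp0 hp
  obtain ⟨K, hK⟩ := hμ
  obtain ⟨F, hF⟩ := hν
  have := SwitchWalk.countable_of_group_fg Γ
  have := SwitchWalk.countable_of_group_fg Λ
  exact SwitchWalk.le_entropy_switchWalkSwitch o μ ν K (SwitchWalk.real_eq_one_of_compl hK) F
    (SwitchWalk.real_eq_one_of_compl hF) hn hp0 hp
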